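/- Let $\lambda>0$ and $v\in\mathbb R^2$. For a symmetric matrix $\xi\in\mathbb R^{2\times 2}_{\mathrm{sym}}$ let $$S(v,\xi)=\mathbf g(v)^{-1/2}\,\frac{\xi}{\sqrt{1+|v|^2}}\,\mathbf g(v)^{-1/2},\qquad \mathbf g(v)=\mathrm{Id}_{2\times 2}+v\otimes v .$$ For a $2\times2$ matrix $A$ let $|A|$ be its Frobenius norm, and set $F_\lambda(A)=0$ if $A=0$ and $F_\lambda(A)=|A|^2+\lambda$ otherwise; for symmetric $A$ let $\rho^0(A)$ be the sum of the absolute values of the two eigenvalues of $A$, counted with multiplicity. Let $$f_\lambda(v,\xi)=\lambda^{-1/2}F_\lambda(S(v,\xi))\sqrt{1+|v|^2},$$ and let $$Q_2f_\lambda(v,\xi)=\inf\Big\{\int_{Q}f_\lambda(v,\xi+\nabla^2\varphi(x))\,dx:\ \varphi\in W^{2,\infty}_0(Q)\Big\},\qquad Q=[-1/2,1/2]^2,$$ be the 2-quasiconvexification of $f_\lambda(v,\cdot)$, where $W^{2,\infty}_0(Q)=W^{2,\infty}(Q)\cap W^{2,1}_0(Q)$ and $W^{2,1}_0(Q)$ is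 the closure in $W^{2,1}$ of the smooth functions with compact support in the interior of $Q$. Then all these integrals exist and are finite, and for every $\xi\in\mathbb R^{2\times 2}_{\mathrm{sym}}$ $$Q_2f_\lambda(v,\xi)=\sqrt{1+|v|^2}\begin{cases}2\rho^0(S(v,\xi))-2\,\dfrac{|\det S(v,\xi)|}{\sqrt\lambda}&\text{if }\rho^0(S(v,\xi))\le\sqrt\lambda,\\[2mm]\dfrac{|S(v,\xi)|^2}{\sqrt\lambda}+\sqrt\lambda&\text{otherwise.}\end{cases}$$ -/

import Mathlib

open MeasureTheory Filter Topology
open scoped ENNReal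

noncomputable section

namespace WillmoreGraph

/-- The plane `ℝ²` with its Euclidean norm. -/
abbrev Plane : Type := EuclideanSpace ℝ (Fin 2)

/-- Real `2 × 2` matrices. -/
abbrev Mat : Type := Matrix (Fin 2) (Fin 2) ℝ

/-! ### The integrand -/

/-- `g(v) = id + v ⊗ v`. -/
def metric (v : Plane) : Mat := 1 + Matrix.of fun i j => v i * v j

/-- `g(v)^{-1/2}`, by the functional calculus of symmetric matrices. -/
def metricInvSqrt (v : Plane) : Mat := cfc (fun t : ℝ => t ^ (-(1 / 2) : ℝ)) (metric v)

/-- `II(v, ξ) = ξ / √(1 + |v|²)`. -/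
def secondForm (v : Plane) (ξ : Mat) : Mat := (1 / √(1 + ‖v‖ ^ 2)) • ξ

/-- `S(v, ξ) = g(v)^{-1/2} II(v, ξ) g(v)^{-1/2}`. -/
def shape (v : Plane) (ξ : Mat) : Mat := metricInvSqrt v * secondForm v ξ * metricInvSqrt v

/-- `|A|²`, the square of the Frobenius (Euclidean) norm. -/
def frobSq (A : Mat) : ℝ := ∑ i, ∑ j, A i j ^ 2

/-- `ρ⁰(A)`: the sum of the absolute values of the eigenvalues, counted with multiplicity,
of a symmetric matrix. -/
def rho (A : Mat) (hA : A.IsHermitian) : ℝ := ∑ i, |hA.eigenvalues i|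

/-- `F_λ(A) = 0` if `A = 0` and `|A|² + λ` otherwise. -/
def bigF (lam : ℝ) (A : Mat) : ℝ := if A = 0 then 0 else frobSq A + lam

/-- `f_λ(v, ξ) = λ^{-1/2} F_λ(S(v, ξ)) √(1 + |v|²)`. -/
def integrand (lam : ℝ) (v : Plane) (ξ : Mat) : ℝ :=
  lam ^ (-(1 / 2) : ℝ) * bigF lam (shape v ξ) * √(1 + ‖v‖ ^ 2)

/-- `S(v, ξ)` is symmetric when `ξ` is, so that `ρ⁰(S(v, ξ))` makes sense. -/
theorem shape_isHermitian (v : Plane) {ξ : Mat} (hξ : ξ.IsSymm) : (shape v ξ).IsHermitian := by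
  have hP : (metricInvSqrt v).conjTranspose = metricInvSqrt v := by
    have h : IsSelfAdjoint (metricInvSqrt v) := cfc_predicate _ _
    exact h
  have hξ' : (secondForm v ξ).conjTranspose = secondForm v ξ := by
    rw [secondForm, Matrix.conjTranspose_smul, Matrix.conjTranspose_eq_transpose_of_trivial,
      hξ.eq, star_trivial]
  rw [Matrix.IsHermitian, shape, Matrix.conjTranspose_mul, Matrix.conjTranspose_mul, hP, hξ',
    Matrix.mul_assoc]

/-! ### Second order Sobolev functions on the unit square -/

/-- The square `Q = [-1/2, 1/2]²`. -/
def square : Set Plane := {x | ∀ i, x i ∈ Set.Icc (-(1 / 2) : ℝ) (1 / 2)}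

/-- The interior of `Q`, as an open set. -/
def squareInterior : TopologicalSpace.Opens Plane := ⟨interior square, isOpen_interior⟩

/-- Smooth real functions with compact support in the interior of `Q`. -/
abbrev Test : Type := TestFunction squareInterior ℝ (⊤ : ℕ∞)

/-- The `i`-th classical partial derivative. -/
def partialD (i : Fin 2) (u : Plane → ℝ) (x : Plane) : ℝ :=
  fderiv ℝ u x (EuclideanSpace.single i 1)

/-- `w` is the weak `i`-th partial derivative of `u` in the interior of `Q`. -/
def IsWeakPartial (i : Fin 2) (u w : Plane → ℝ) : Prop :=
  ∀ ψ : Test, ∫ x in interior square, u x * partialD i ψ x = -∫ x in interior square, w x * ψ x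

/-- `φ ∈ W^{2,∞}(Q)`, with weak gradient `G` and weak Hessian `H`. -/
structure IsW2Infty (φ : Plane → ℝ) (G : Fin 2 → Plane → ℝ) (H : Plane → Mat) : Prop where
  bounded : MemLp φ ∞ (volume.restrict square)
  bounded_grad : ∀ i, MemLp (G i) ∞ (volume.restrict square)
  bounded_hess : ∀ i j, MemLp (fun x => H x i j) ∞ (volume.restrict square)
  grad : ∀ i, IsWeakPartial i φ (G i)
  hess : ∀ i j, IsWeakPartial j (G i) (fun x => H x i j)

/-- `φ`, with gradient `G` and Hessian `H`, belongs to `W^{2,1}_0(Q)`, the closure of the test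
functions in the norm of `W^{2,1}(Q)`. -/
def IsInW21Zero (φ : Plane → ℝ) (G : Fin 2 → Plane → ℝ) (H : Plane → Mat) : Prop :=
  ∃ ψ : ℕ → Test,
    Tendsto (fun n => eLpNorm (fun x => φ x - ψ n x) 1 (volume.restrict square)) atTop (𝓝 0) ∧
    (∀ i, Tendsto (fun n => eLpNorm (fun x => G i x - partialD i (ψ n) x) 1
      (volume.restrict square)) atTop (𝓝 0)) ∧
    ∀ i j, Tendsto (fun n => eLpNorm (fun x => H x i j - partialD j (partialD i (ψ n)) x) 1
      (volume.restrict square)) atTop (𝓝 0)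

/-- `φ ∈ W^{2,∞}_0(Q) = W^{2,∞}(Q) ∩ W^{2,1}_0(Q)`, with weak gradient `G` and weak
Hessian `H`. -/
def IsW2InftyZero (φ : Plane → ℝ) (G : Fin 2 → Plane → ℝ) (H : Plane → Mat) : Prop :=
  IsW2Infty φ G H ∧ IsInW21Zero φ G H

/-- The 2-quasiconvexification
`Q₂f(ξ) = inf {∫_Q f(ξ + ∇²φ) dx : φ ∈ W^{2,∞}_0(Q)}`, as an infimum in `[-∞, ∞]`. -/
def quasiconvexification (f : Mat → ℝ) (ξ : Mat) : EReal :=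
  ⨅ (φ : Plane → ℝ) (G : Fin 2 → Plane → ℝ) (H : Plane → Mat) (_ : IsW2InftyZero φ G H),
    ((∫ x in square, f (ξ + H x) : ℝ) : EReal)

end WillmoreGraph

end

/-!
After a congruence `ξ ↦ N ξ Nᵀ` the shape operator is diagonal, with its eigenvalues `dᵢ` as
entries. Affine functions plus multiples of the determinant have the same integral along all
Hessians of `W^{2,∞}_0` perturbations. Completing the square in `|A|² + λ` gives such a function
below `F_λ` on symmetric matrices, touching it at `0` and at the diagonal matrices whose signed
trace `∑ᵢ σᵢ Aᵢᵢ` equals `m = √λ`; this is the lower bound. If `∑ᵢ |dᵢ| ≤ √λ`, splitting `diag d`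
twice along rank-one segments in the coordinate directions ends at contact points, and smooth
oscillating profiles, cut off inside the phase being split, realise these laminates up to small
measure. Otherwise `m = ∑ᵢ |dᵢ|` already makes `diag d` itself a contact point.
-/

noncomputable section

namespace WillmoreGraph

/-! ### Oscillating profiles of one variable -/

theorem exists_pos_forall_measure_ball_le {X : Type*} [PseudoMetricSpace X] [MeasurableSpace X]
    [BorelSpace X] (μ : Measure X) [IsFiniteMeasure μ] [NullSingletonClass μ] {K : Set X}
    (hK : IsCompact K) {κ : ℝ≥0∞} (hκ : 0 < κ) :
    ∃ δ > 0, ∀ a ∈ K, μ (Metric.ball a δ) ≤ κ := by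
  have hopen (a : X) : ∃ U ⊇ {a}, IsOpen U ∧ μ U < κ :=
    Set.exists_isOpen_lt_of_lt {a} κ (by rwa [measure_singleton])
  choose U haU hU hUκ using hopen
  obtain ⟨δ, hδ, hball⟩ := lebesgue_number_lemma_of_metric hK hU
    fun a _ => Set.mem_iUnion.2 ⟨a, haU a rfl⟩
  refine ⟨δ, hδ, fun a ha => ?_⟩
  obtain ⟨b, hb⟩ := hball a ha
  exact (measure_mono hb).trans (hUκ b).le

theorem countable_setOf_cos_mul_eq {ω : ℝ} (hω : ω ≠ 0) (c : ℝ) :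
    {x : ℝ | Real.cos (ω * x) = c}.Countable := by
  by_cases h : ∃ y, Real.cos y = c
  · obtain ⟨y, rfl⟩ := h
    refine ((Set.countable_range fun k : ℤ => (2 * k * Real.pi + y) / ω).union
      (Set.countable_range fun k : ℤ => (2 * k * Real.pi - y) / ω)).mono fun x hx => ?_
    obtain ⟨k, hk | hk⟩ := Real.cos_eq_cos_iff.1 (Eq.symm hx)
    · exact Or.inl ⟨k, (eq_div_of_mul_eq hω ((mul_comm _ _).trans hk)).symm⟩
    · exact Or.inr ⟨k, (eq_div_of_mul_eq hω ((mul_comm _ _).trans hk)).symm⟩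
  · rw [Set.eq_empty_of_forall_notMem fun x hx => h ⟨_, hx⟩]
    exact Set.countable_empty

theorem nullSingletonClass_map_of_countable_preimage {X Y : Type*} [MeasurableSpace X]
    [MeasurableSpace Y] [MeasurableSingletonClass Y] (μ : Measure X) [NullSingletonClass μ]
    {f : X → Y} (hf : Measurable f) (hcount : ∀ y, (f ⁻¹' {y}).Countable) :
    NullSingletonClass (μ.map f) :=
  ⟨fun y => by
    rw [Measure.map_apply hf (measurableSet_singleton y), (hcount y).measure_zero]⟩

/-- A smooth `T`-periodic function with values between `s` and `t`: it equals `t` where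
`cos (2πx/T) ≤ a` and `s` where `cos (2πx/T) ≥ a + δ`. -/
def oscillation (s t T δ a x : ℝ) : ℝ :=
  t + (s - t) * Real.smoothTransition ((Real.cos (2 * Real.pi / T * x) - a) / δ)

section Oscillation

variable {s t T δ a : ℝ}

theorem contDiff_oscillation : ContDiff ℝ (⊤ : ℕ∞) (oscillation s t T δ a) := by
  unfold oscillation
  exact contDiff_const.add (contDiff_const.mul (Real.smoothTransition.contDiff.comp
    (((Real.contDiff_cos.comp (contDiff_const.mul contDiff_id)).sub contDiff_const).div_const δ)))

theorem periodic_oscillation (hT : T ≠ 0) : Function.Periodic (oscillation s t T δ a) T := by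
  intro x
  have hphase : 2 * Real.pi / T * (x + T) = 2 * Real.pi / T * x + 2 * Real.pi := by field_simp
  rw [oscillation, hphase, Real.cos_add_two_pi, oscillation]

theorem abs_oscillation_le (x : ℝ) : |oscillation s t T δ a x| ≤ |s| + |t| := by
  set θ := Real.smoothTransition ((Real.cos (2 * Real.pi / T * x) - a) / δ) with hθ
  have hθ0 : 0 ≤ θ := Real.smoothTransition.nonneg _
  have hθ1 : θ ≤ 1 := Real.smoothTransition.le_one _
  calc |oscillation s t T δ a x| = |θ * s + (1 - θ) * t| := by
        rw [oscillation, ← hθ]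
        ring_nf
    _ ≤ θ * |s| + (1 - θ) * |t| := by
        refine (abs_add_le _ _).trans_eq ?_
        rw [abs_mul, abs_mul, abs_of_nonneg hθ0, abs_of_nonneg (sub_nonneg.2 hθ1)]
    _ ≤ |s| + |t| := by nlinarith [abs_nonneg s, abs_nonneg t]

theorem oscillation_of_cos_le (hδ : 0 < δ) {x : ℝ} (hx : Real.cos (2 * Real.pi / T * x) ≤ a) :
    oscillation s t T δ a x = t := by
  rw [oscillation, Real.smoothTransition.zero_of_nonpos
    (div_nonpos_of_nonpos_of_nonneg (sub_nonpos.2 hx) hδ.le), mul_zero, add_zero]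

theorem oscillation_of_le_cos (hδ : 0 < δ) {x : ℝ} (hx : a + δ ≤ Real.cos (2 * Real.pi / T * x)) :
    oscillation s t T δ a x = s := by
  rw [oscillation, Real.smoothTransition.one_of_one_le ((one_le_div hδ).2 (by linarith))]
  ring

theorem exists_integral_oscillation_eq_zero (hst : s * t ≤ 0) (T : ℝ) (hδ : 0 < δ) :
    ∃ a ∈ Set.Icc (-1 - δ) 1, ∫ x in (0)..T, oscillation s t T δ a x = 0 := by
  have hcont : Continuous fun a => ∫ x in (0)..T, oscillation s t T δ a x := by
    apply intervalIntegral.continuous_parametric_intervalIntegral_of_continuous'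
    unfold Function.uncurry oscillation
    have := Real.smoothTransition.continuous
    fun_prop
  have hleft : ∫ x in (0)..T, oscillation s t T δ (-1 - δ) x = T * s := by
    simp only [oscillation_of_le_cos hδ
      ((by linarith : -1 - δ + δ ≤ -1).trans (Real.neg_one_le_cos _))]
    simp
  have hright : ∫ x in (0)..T, oscillation s t T δ 1 x = T * t := by
    simp only [oscillation_of_cos_le hδ (Real.cos_le_one _)]
    simp
  have hzero : (0 : ℝ) ∈ Set.uIcc (T * s) (T * t) := by
    have hprod : T * s * (T * t) ≤ 0 := by nlinarith [mul_self_nonneg T]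
    rcases mul_nonpos_iff.1 hprod with ⟨hs, ht⟩ | ⟨hs, ht⟩
    · exact Set.mem_uIcc.2 (Or.inr ⟨ht, hs⟩)
    · exact Set.mem_uIcc.2 (Or.inl ⟨hs, ht⟩)
  rw [← hleft, ← hright] at hzero
  obtain ⟨a, ha, ha0⟩ := intermediate_value_uIcc hcont.continuousOn hzero
  rw [Set.uIcc_of_le (by linarith)] at ha
  exact ⟨a, ha, ha0⟩

theorem setOf_not_eventuallyEq_oscillation_subset (hδ : 0 < δ) :
    {x | ¬ oscillation s t T δ a =ᶠ[𝓝 x] (fun _ => s) ∧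
      ¬ oscillation s t T δ a =ᶠ[𝓝 x] (fun _ => t)} ⊆
    (fun x => Real.cos (2 * Real.pi / T * x)) ⁻¹' Set.Icc a (a + δ) := by
  have hcos : Continuous fun x => Real.cos (2 * Real.pi / T * x) := by fun_prop
  rintro x ⟨hs, ht⟩
  constructor
  · by_contra! hx
    refine ht ?_
    filter_upwards [hcos.continuousAt.eventually_lt_const hx] with y hy
    exact oscillation_of_cos_le hδ hy.le
  · by_contra! hx
    refine hs ?_
    filter_upwards [hcos.continuousAt.eventually_const_lt hx] with y hy
    exact oscillation_of_le_cos hδ hy.le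

theorem exists_oscillation (ν : Measure ℝ) [IsFiniteMeasure ν] [NullSingletonClass ν]
    (hst : s * t ≤ 0) (hT : 0 < T) {κ : ℝ} (hκ : 0 < κ) :
    ∃ δ a : ℝ, ∫ x in (0)..T, oscillation s t T δ a x = 0 ∧
      ν.real {x | ¬ oscillation s t T δ a =ᶠ[𝓝 x] (fun _ => s) ∧
        ¬ oscillation s t T δ a =ᶠ[𝓝 x] (fun _ => t)} ≤ κ := by
  have hcos : Measurable fun x => Real.cos (2 * Real.pi / T * x) := by fun_prop
  have hω : 2 * Real.pi / T ≠ 0 := by positivity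
  have := nullSingletonClass_map_of_countable_preimage ν hcos (countable_setOf_cos_mul_eq hω)
  obtain ⟨r, hr, hball⟩ := exists_pos_forall_measure_ball_le
    (ν.map fun x => Real.cos (2 * Real.pi / T * x)) (isCompact_Icc (a := (-2 : ℝ)) (b := 1))
    (ENNReal.ofReal_pos.2 hκ)
  set δ := min 1 (r / 2)
  have hδ : 0 < δ := lt_min one_pos (half_pos hr)
  have hδ1 : δ ≤ 1 := min_le_left _ _
  have hδr : δ ≤ r / 2 := min_le_right _ _
  obtain ⟨a, ha, hmean⟩ := exists_integral_oscillation_eq_zero hst T hδ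
  have hsub : Set.Icc a (a + δ) ⊆ Metric.ball a r := fun y hy => by
    rw [Metric.mem_ball, Real.dist_eq, abs_lt]
    constructor <;> linarith [hy.1, hy.2]
  refine ⟨δ, a, hmean, ENNReal.toReal_le_of_le_ofReal hκ.le ?_⟩
  calc ν _ ≤ ν ((fun x => Real.cos (2 * Real.pi / T * x)) ⁻¹' Metric.ball a r) :=
        measure_mono ((setOf_not_eventuallyEq_oscillation_subset hδ).trans
          (Set.preimage_mono hsub))
    _ ≤ ENNReal.ofReal κ := by
        rw [← Measure.map_apply hcos measurableSet_ball]
        exact hball a ⟨by linarith [ha.1], ha.2⟩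

theorem abs_integral_le_of_periodic {g : ℝ → ℝ} {M : ℝ} (hg : Continuous g)
    (hper : Function.Periodic g T) (hT : 0 < T) (hmean : ∫ x in (0)..T, g x = 0)
    (hM : ∀ x, |g x| ≤ M) (x : ℝ) : |∫ y in (0)..x, g y| ≤ M * T := by
  have hM0 : 0 ≤ M := (abs_nonneg _).trans (hM 0)
  have hprim : Function.Periodic (fun x => ∫ y in (0)..x, g y) T := fun x => by
    dsimp only
    rw [← intervalIntegral.integral_add_adjacent_intervals (hg.intervalIntegrable 0 x)
      (hg.intervalIntegrable x (x + T)), hper.intervalIntegral_add_eq x 0, zero_add, hmean,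
      add_zero]
  obtain ⟨y, hy, hxy⟩ := hprim.exists_mem_Ico₀ hT x
  rw [hxy]
  calc |∫ z in (0)..y, g z| ≤ M * |y - 0| :=
        intervalIntegral.norm_integral_le_of_norm_le_const (f := g) fun z _ => hM z
    _ ≤ M * T := by
        rw [sub_zero, abs_of_nonneg hy.1]
        exact mul_le_mul_of_nonneg_left hy.2.le hM0

theorem contDiff_integral {g : ℝ → ℝ} (hg : ContDiff ℝ (⊤ : ℕ∞) g) :
    ContDiff ℝ (⊤ : ℕ∞) fun x => ∫ y in (0)..x, g y := by
  refine contDiff_infty_iff_deriv.2 ⟨fun x =>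
    (hg.continuous.integral_hasStrictDerivAt 0 x).hasDerivAt.differentiableAt, ?_⟩
  rwa [funext (hg.continuous.deriv_integral g 0)]

theorem exists_profile (ν : Measure ℝ) [IsFiniteMeasure ν] [NullSingletonClass ν]
    (hst : s * t ≤ 0) (R : ℝ) {κ : ℝ} (hκ : 0 < κ) :
    ∃ w : ℝ → ℝ, ContDiff ℝ (⊤ : ℕ∞) w ∧ (∀ x, |x| ≤ R → |w x| ≤ κ) ∧
      (∀ x, |deriv w x| ≤ κ) ∧ (∀ x, |deriv (deriv w) x| ≤ |s| + |t|) ∧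
      ν.real {x | ¬ deriv (deriv w) =ᶠ[𝓝 x] (fun _ => s) ∧
        ¬ deriv (deriv w) =ᶠ[𝓝 x] (fun _ => t)} ≤ κ := by
  set T := κ / ((|s| + |t| + 1) * (|R| + 1))
  have hT : 0 < T := by positivity
  have hTκ : (|s| + |t|) * T * (|R| + 1) ≤ κ := by
    have hT' : (|s| + |t| + 1) * T * (|R| + 1) = κ := by
      simp only [T]
      field_simp
    nlinarith [mul_pos hT (by positivity : 0 < |R| + 1)]
  obtain ⟨δ, a, hmean, hbad⟩ := exists_oscillation ν hst hT hκ
  set g := oscillation s t T δ a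
  have hg : ContDiff ℝ (⊤ : ℕ∞) g := contDiff_oscillation
  set G : ℝ → ℝ := fun x => ∫ y in (0)..x, g y
  have hG : ContDiff ℝ (⊤ : ℕ∞) G := contDiff_integral hg
  have hGT (x : ℝ) : |G x| ≤ (|s| + |t|) * T :=
    abs_integral_le_of_periodic hg.continuous (periodic_oscillation hT.ne') hT hmean
      abs_oscillation_le x
  have hderivG : deriv G = g := funext (hg.continuous.deriv_integral g 0)
  have hderiv : deriv (fun x => ∫ y in (0)..x, G y) = G :=
    funext (hG.continuous.deriv_integral G 0)
  have hM : 0 ≤ (|s| + |t|) * T := by positivity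
  refine ⟨fun x => ∫ y in (0)..x, G y, contDiff_integral hG, fun x hx => ?_, fun x => ?_, ?_, ?_⟩
  · calc |∫ y in (0)..x, G y| ≤ (|s| + |t|) * T * |x - 0| :=
          intervalIntegral.norm_integral_le_of_norm_le_const (f := G) fun y _ => hGT y
      _ ≤ (|s| + |t|) * T * (|R| + 1) := by
          rw [sub_zero]
          exact mul_le_mul_of_nonneg_left (by linarith [le_abs_self R]) hM
      _ ≤ κ := hTκ
  · rw [hderiv]
    nlinarith [hGT x, abs_nonneg R]
  · rw [hderiv, hderivG]
    exact abs_oscillation_le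
  · rwa [hderiv, hderivG]

end Oscillation

/-! ### Smooth functions on the square -/

theorem square_eq_preimage :
    square = (fun x : Plane => (x.ofLp : Fin 2 → ℝ)) ⁻¹'
      Set.Icc (fun _ => -(1 / 2)) (fun _ => 1 / 2) := by
  ext x
  simp only [square, Set.mem_ofPred_eq, Set.mem_preimage, Set.mem_Icc, Pi.le_def]
  exact forall_and

theorem volume_square : volume square = 1 := by
  rw [square_eq_preimage, (PiLp.volume_preserving_ofLp (Fin 2)).measure_preimage
    measurableSet_Icc.nullMeasurableSet, Real.volume_Icc_pi]
  norm_num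

instance : IsProbabilityMeasure (volume.restrict square) :=
  ⟨by rw [Measure.restrict_apply_univ, volume_square]⟩

theorem convex_square : Convex ℝ square := by
  rw [square_eq_preimage]
  exact (convex_Icc _ _).linear_preimage (WithLp.linearEquiv 2 ℝ (Fin 2 → ℝ)).toLinearMap

theorem restrict_interior_square : volume.restrict (interior square) = volume.restrict square :=
  Measure.restrict_congr_set
    (interior_ae_eq_of_null_frontier (convex_square.addHaar_frontier volume))

/-- The classical Hessian matrix, whose `(i, j)` entry is `∂ⱼ ∂ᵢ u`. -/
def hess (u : Plane → ℝ) (x : Plane) : Mat := Matrix.of fun i j => partialD j (partialD i u) x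

theorem hess_apply (u : Plane → ℝ) (x : Plane) (i j : Fin 2) :
    hess u x i j = partialD j (partialD i u) x := rfl

section Calculus

variable {u v : Plane → ℝ} {x : Plane}

theorem contDiff_partialD (hu : ContDiff ℝ (⊤ : ℕ∞) u) (i : Fin 2) :
    ContDiff ℝ (⊤ : ℕ∞) (partialD i u) :=
  (hu.fderiv_right (m := (⊤ : ℕ∞)) (by simp)).clm_apply contDiff_const

theorem tsupport_partialD_subset (u : Plane → ℝ) (i : Fin 2) :
    tsupport (partialD i u) ⊆ tsupport u := by
  refine (closure_mono fun x hx => ?_).trans (tsupport_fderiv_subset ℝ (f := u))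
  exact fun hz => hx (by rw [partialD, hz, zero_apply])

theorem partialD_comm (hu : ContDiff ℝ (⊤ : ℕ∞) u) (i j : Fin 2) :
    partialD j (partialD i u) = partialD i (partialD j u) := by
  funext x
  have hd : DifferentiableAt ℝ (fderiv ℝ u) x :=
    (hu.fderiv_right (m := (⊤ : ℕ∞)) (by simp)).differentiable (by simp) x
  have hsecond (i j : Fin 2) : partialD j (partialD i u) x =
      fderiv ℝ (fderiv ℝ u) x (EuclideanSpace.single j 1) (EuclideanSpace.single i 1) := by
    unfold partialD
    rw [fderiv_clm_apply hd (differentiableAt_const _)]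
    simp
  rw [hsecond, hsecond]
  exact (hu.contDiffAt.isSymmSndFDerivAt
    (by simpa using WithTop.coe_le_coe.2 (le_top (a := (2 : ℕ∞))))).eq _ _

theorem partialD_const (i : Fin 2) (c : ℝ) : partialD i (fun _ => c) = fun _ => 0 := by
  funext x
  simp [partialD]

theorem hess_zero : hess (fun _ => 0) = fun _ => 0 := by
  funext x
  ext i j
  rw [hess_apply, partialD_const, partialD_const, Matrix.zero_apply]

theorem partialD_add (hu : ContDiff ℝ (⊤ : ℕ∞) u) (hv : ContDiff ℝ (⊤ : ℕ∞) v) (i : Fin 2) :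
    partialD i (fun x => u x + v x) = fun x => partialD i u x + partialD i v x := by
  funext x
  rw [partialD, fderiv_fun_add (hu.differentiable (by simp) x) (hv.differentiable (by simp) x)]
  rfl

theorem hess_add (hu : ContDiff ℝ (⊤ : ℕ∞) u) (hv : ContDiff ℝ (⊤ : ℕ∞) v) :
    hess (fun x => u x + v x) = fun x => hess u x + hess v x := by
  funext x
  ext i j
  rw [hess_apply, partialD_add hu hv,
    partialD_add (contDiff_partialD hu i) (contDiff_partialD hv i)]
  rfl

theorem partialD_mul (hu : ContDiff ℝ (⊤ : ℕ∞) u) (hv : ContDiff ℝ (⊤ : ℕ∞) v) (i : Fin 2) :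
    partialD i (fun x => u x * v x) = fun x => u x * partialD i v x + v x * partialD i u x := by
  funext x
  rw [partialD, fderiv_fun_mul (hu.differentiable (by simp) x) (hv.differentiable (by simp) x)]
  rfl

theorem partialD_comp_inner {w : ℝ → ℝ} (hw : ContDiff ℝ (⊤ : ℕ∞) w) (p : Plane) (i : Fin 2) :
    partialD i (fun x => w (inner ℝ p x)) = fun x => p i * deriv w (inner ℝ p x) := by
  funext x
  have hderiv : HasFDerivAt (fun x => w (inner ℝ p x)) (deriv w (inner ℝ p x) • innerSL ℝ p) x :=
    (hw.differentiable (by simp) _).hasDerivAt.comp_hasFDerivAt x (innerSL ℝ p).hasFDerivAt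
  rw [partialD, hderiv.fderiv]
  simp [EuclideanSpace.inner_single_right, mul_comm]

theorem contDiff_comp_inner {w : ℝ → ℝ} (hw : ContDiff ℝ (⊤ : ℕ∞) w) (p : Plane) :
    ContDiff ℝ (⊤ : ℕ∞) fun x : Plane => w (inner ℝ p x) :=
  hw.comp (innerSL ℝ p).contDiff

theorem hess_comp_inner_apply {w : ℝ → ℝ} (hw : ContDiff ℝ (⊤ : ℕ∞) w) (p x : Plane)
    (i j : Fin 2) :
    hess (fun x => w (inner ℝ p x)) x i j = deriv (deriv w) (inner ℝ p x) * (p i * p j) := by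
  have hw' : ContDiff ℝ (⊤ : ℕ∞) (deriv w) := (contDiff_infty_iff_deriv.1 hw).2
  rw [hess_apply, partialD_comp_inner hw,
    partialD_mul contDiff_const (contDiff_comp_inner hw' p), partialD_comp_inner hw',
    partialD_const]
  ring

theorem hess_mul_comp_inner_apply (hu : ContDiff ℝ (⊤ : ℕ∞) u) {w : ℝ → ℝ}
    (hw : ContDiff ℝ (⊤ : ℕ∞) w) (p x : Plane) (i j : Fin 2) :
    hess (fun x => u x * w (inner ℝ p x)) x i j =
      u x * (deriv (deriv w) (inner ℝ p x) * (p i * p j)) +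
      (hess u x i j * w (inner ℝ p x) + partialD i u x * deriv w (inner ℝ p x) * p j +
        partialD j u x * deriv w (inner ℝ p x) * p i) := by
  have hwp := contDiff_comp_inner hw p
  have hww : partialD j (partialD i fun x => w (inner ℝ p x)) x = _ :=
    hess_comp_inner_apply hw p x i j
  rw [hess_apply, hess_apply u, partialD_mul hu hwp, partialD_add
    (hu.mul (contDiff_partialD hwp i)) (hwp.mul (contDiff_partialD hu i)),
    partialD_mul hu (contDiff_partialD hwp i), partialD_mul hwp (contDiff_partialD hu i)]
  dsimp only
  rw [hww, partialD_comp_inner hw, partialD_comp_inner hw]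
  ring

theorem hess_congr (h : u =ᶠ[𝓝 x] v) : hess u =ᶠ[𝓝 x] hess v := by
  have hpartial {u v : Plane → ℝ} (h : u =ᶠ[𝓝 x] v) (i : Fin 2) :
      partialD i u =ᶠ[𝓝 x] partialD i v :=
    h.fderiv.fun_comp fun L => L (EuclideanSpace.single i 1)
  have hentry (i j : Fin 2) : (fun y => hess u y i j) =ᶠ[𝓝 x] fun y => hess v y i j :=
    hpartial (hpartial h i) j
  filter_upwards [eventually_all.2 fun i => eventually_all.2 (hentry i)] with y hy
  exact Matrix.ext hy

end Calculus

/-- The partial derivative of a test function, as a test function. -/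
def Test.partialD (ψ : Test) (i : Fin 2) : Test where
  toFun := WillmoreGraph.partialD i ψ
  contDiff' := contDiff_partialD ψ.contDiff i
  hasCompactSupport' := ψ.hasCompactSupport.mono' ((subset_tsupport _).trans
    (tsupport_partialD_subset ψ i))
  tsupport_subset' := (tsupport_partialD_subset ψ i).trans ψ.tsupport_subset

@[simp]
theorem Test.coe_partialD (ψ : Test) (i : Fin 2) :
    (Test.partialD ψ i : Plane → ℝ) = WillmoreGraph.partialD i ψ := rfl

/-- The product of a test function with a smooth function, as a test function. -/
def Test.mulSmooth (η : Test) (u : Plane → ℝ) (hu : ContDiff ℝ (⊤ : ℕ∞) u) : Test where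
  toFun x := η x * u x
  contDiff' := η.contDiff.mul hu
  hasCompactSupport' := η.hasCompactSupport.mul_right
  tsupport_subset' := (tsupport_mul_subset_left (f := η) (g := u)).trans η.tsupport_subset

theorem Test.memLp_top (ψ : Test) : MemLp ψ ∞ (volume.restrict square) :=
  (ψ.continuous.memLp_top_of_hasCompactSupport ψ.hasCompactSupport volume).restrict _

theorem Test.exists_forall_abs_le {ι : Type*} [Finite ι] (ψ : ι → Test) :
    ∃ C, ∀ k x, |ψ k x| ≤ C := by
  have hbdd (k : ι) : ∃ C, ∀ x, |ψ k x| ≤ C :=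
    (ψ k).hasCompactSupport.exists_bound_of_continuous (ψ k).continuous
  choose C hC using hbdd
  obtain ⟨M, hM⟩ := Finite.exists_le C
  exact ⟨M, fun k x => (hC k x).trans (hM k)⟩

theorem Test.exists_bound_hess (ψ : Test) : ∃ C, ∀ x i j, |hess ψ x i j| ≤ C := by
  obtain ⟨C, hC⟩ := exists_forall_abs_le fun k : Fin 2 × Fin 2 => (ψ.partialD k.1).partialD k.2
  exact ⟨C, fun x i j => hC (i, j) x⟩

theorem Test.setIntegral_mul (u : Plane → ℝ) (ψ : Test) :
    ∫ x in interior square, u x * ψ x = ∫ x, u x * ψ x :=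
  setIntegral_eq_integral_of_forall_compl_eq_zero fun x hx => by
    rw [image_eq_zero_of_notMem_tsupport fun h => hx (ψ.tsupport_subset h), mul_zero]

theorem Test.integrable_mul {u : Plane → ℝ} (hu : Continuous u) (ψ : Test) :
    Integrable fun x => u x * ψ x :=
  (hu.mul ψ.continuous).integrable_of_hasCompactSupport ψ.hasCompactSupport.mul_left

theorem isWeakPartial_of_contDiff {u : Plane → ℝ} (hu : ContDiff ℝ (⊤ : ℕ∞) u) (i : Fin 2) :
    IsWeakPartial i u (partialD i u) := by
  intro ψ
  rw [Test.setIntegral_mul, ← Test.coe_partialD, Test.setIntegral_mul]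
  exact integral_mul_fderiv_eq_neg_fderiv_mul_of_integrable
    (Test.integrable_mul (contDiff_partialD hu i).continuous ψ)
    (Test.integrable_mul hu.continuous (ψ.partialD i))
    (Test.integrable_mul hu.continuous ψ)
    (fun x _ => hu.differentiable (by simp) x)
    (fun x _ => ψ.contDiff.differentiable (by simp) x)

theorem Test.isW2InftyZero (ψ : Test) :
    IsW2InftyZero ψ (fun i => WillmoreGraph.partialD i ψ) (hess ψ) :=
  ⟨⟨ψ.memLp_top, fun i => (ψ.partialD i).memLp_top,
    fun i j => ((ψ.partialD i).partialD j).memLp_top, isWeakPartial_of_contDiff ψ.contDiff,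
    fun i => isWeakPartial_of_contDiff (contDiff_partialD ψ.contDiff i)⟩,
    fun _ => ψ, by simp, by simp, by simp [hess_apply]⟩

theorem integral_partialD_eq_zero (ψ : Test) (i : Fin 2) :
    ∫ x in square, partialD i ψ x = 0 := by
  have h := isWeakPartial_of_contDiff (u := fun _ => (1 : ℝ)) contDiff_const i ψ
  simpa [partialD_const, restrict_interior_square] using h

/-! ### Null Lagrangians -/

theorem tendsto_integral_mul_of_eLpNorm_sub {X : Type*} [MeasurableSpace X] {μ : Measure X}
    [IsFiniteMeasure μ] {h f : X → ℝ} {g : ℕ → X → ℝ} (hh : MemLp h ∞ μ) (hf : MemLp f ∞ μ)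
    (hg : ∀ n, MemLp (g n) ∞ μ)
    (hlim : Tendsto (fun n => eLpNorm (fun x => f x - g n x) 1 μ) atTop (𝓝 0)) :
    Tendsto (fun n => ∫ x, h x * g n x ∂μ) atTop (𝓝 (∫ x, h x * f x ∂μ)) := by
  have hint {a : X → ℝ} (ha : MemLp a ∞ μ) : Integrable (fun x => h x * a x) μ :=
    (MemLp.mul (r := ∞) ha hh).integrable le_top
  refine tendsto_integral_of_L1 _ (hint hf).aestronglyMeasurable
    (Eventually.of_forall fun n => hint (hg n)) ?_
  have hholder (n : ℕ) : ∫⁻ x, ‖h x * g n x - h x * f x‖ₑ ∂μ ≤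
      eLpNorm h ∞ μ * eLpNorm (fun x => f x - g n x) 1 μ := by
    refine le_trans (le_of_eq ?_) (eLpNorm_smul_le_eLpNorm_top_mul_eLpNorm 1
      (hf.sub (hg n)).aestronglyMeasurable h)
    rw [eLpNorm_one_eq_lintegral_enorm]
    refine lintegral_congr fun x => ?_
    rw [← mul_sub, ← enorm_neg, ← mul_neg, neg_sub]
    rfl
  refine tendsto_of_tendsto_of_tendsto_of_le_of_le tendsto_const_nhds ?_ (fun n => zero_le) hholder
  simpa using ENNReal.Tendsto.const_mul hlim (Or.inr hh.eLpNorm_ne_top)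

section NullLagrangian

variable {φ : Plane → ℝ} {G : Fin 2 → Plane → ℝ} {H : Plane → Mat}

theorem integral_hess_eq_zero (h : IsW2InftyZero φ G H) (i j : Fin 2) :
    ∫ x in square, H x i j = 0 := by
  obtain ⟨hW, ψ, -, -, hH⟩ := h
  have hlim := tendsto_integral_mul_of_eLpNorm_sub (memLp_const 1) (hW.bounded_hess i j)
    (fun n => (((ψ n).partialD i).partialD j).memLp_top) (hH i j)
  have hzero (n : ℕ) : ∫ x in square, ((ψ n).partialD i).partialD j x = 0 :=
    integral_partialD_eq_zero ((ψ n).partialD i) j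
  simp only [one_mul, hzero] at hlim
  exact tendsto_nhds_unique hlim tendsto_const_nhds

theorem isSymm_hess_ae (h : IsW2InftyZero φ G H) :
    ∀ᵐ x ∂(volume.restrict square), (H x).IsSymm := by
  obtain ⟨hW, ψ, -, -, hH⟩ := h
  have hmeas (i j : Fin 2) (n : ℕ) : AEStronglyMeasurable
      (fun x => H x i j - partialD j (partialD i (ψ n)) x) (volume.restrict square) :=
    ((hW.bounded_hess i j).sub (((ψ n).partialD i).partialD j).memLp_top).aestronglyMeasurable
  have hle (n : ℕ) : eLpNorm (fun x => H x 0 1 - H x 1 0) 1 (volume.restrict square) ≤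
      eLpNorm (fun x => H x 0 1 - partialD 1 (partialD 0 (ψ n)) x) 1 (volume.restrict square) +
      eLpNorm (fun x => H x 1 0 - partialD 0 (partialD 1 (ψ n)) x) 1 (volume.restrict square) := by
    refine le_trans (le_of_eq ?_) (eLpNorm_sub_le (hmeas 0 1 n) (hmeas 1 0 n) le_rfl)
    congr 1
    funext x
    rw [Pi.sub_apply, partialD_comm (ψ n).contDiff 0 1, sub_sub_sub_cancel_right]
  have hlim := (hH 0 1).add (hH 1 0)
  rw [add_zero] at hlim
  have hnorm := le_antisymm (ge_of_tendsto' hlim hle) zero_le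
  rw [eLpNorm_eq_zero_iff (f := fun x => H x 0 1 - H x 1 0)
    ((hW.bounded_hess 0 1).sub (hW.bounded_hess 1 0)).aestronglyMeasurable one_ne_zero] at hnorm
  filter_upwards [hnorm] with x hx
  refine Matrix.IsSymm.ext (Fin.forall_fin_two.2 ⟨?_, ?_⟩) <;>
    refine Fin.forall_fin_two.2 ⟨?_, ?_⟩
  · rfl
  · exact (sub_eq_zero.1 hx).symm
  · exact sub_eq_zero.1 hx
  · rfl

theorem memLp_det_hess (h : IsW2Infty φ G H) :
    MemLp (fun x => (H x).det) ∞ (volume.restrict square) := by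
  simp only [Matrix.det_fin_two]
  exact (MemLp.mul (h.bounded_hess 1 1) (h.bounded_hess 0 0)).sub
    (MemLp.mul (h.bounded_hess 1 0) (h.bounded_hess 0 1))

theorem integral_det_hess_eq_zero (h : IsW2InftyZero φ G H) :
    ∫ x in square, (H x).det = 0 := by
  obtain ⟨hW, ψ, -, -, hH⟩ := h
  have hlim (i j k l : Fin 2) : Tendsto (fun n => ∫ x in square,
      H x i j * partialD l (partialD k (ψ n)) x) atTop (𝓝 (∫ x in square, H x i j * H x k l)) :=
    tendsto_integral_mul_of_eLpNorm_sub (hW.bounded_hess i j) (hW.bounded_hess k l)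
      (fun n => (((ψ n).partialD k).partialD l).memLp_top) (hH k l)
  -- both sides equal `-∫ ∂₀φ ∂₀∂₁∂₁ψₙ`
  have hparts (n : ℕ) : ∫ x in square, H x 0 0 * partialD 1 (partialD 1 (ψ n)) x =
      ∫ x in square, H x 0 1 * partialD 0 (partialD 1 (ψ n)) x := by
    have h00 := hW.hess 0 0 (((ψ n).partialD 1).partialD 1)
    have h01 := hW.hess 0 1 (((ψ n).partialD 1).partialD 0)
    simp only [Test.coe_partialD, restrict_interior_square] at h00 h01
    rw [partialD_comm (contDiff_partialD (ψ n).contDiff 1) 1 0] at h00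
    linarith
  have heq : ∫ x in square, H x 0 0 * H x 1 1 = ∫ x in square, H x 0 1 * H x 1 0 :=
    tendsto_nhds_unique ((hlim 0 0 1 1).congr hparts) (hlim 0 1 1 0)
  have hint (i j k l : Fin 2) : Integrable (fun x => H x i j * H x k l) (volume.restrict square) :=
    (MemLp.mul (r := ∞) (hW.bounded_hess k l) (hW.bounded_hess i j)).integrable le_top
  simp only [Matrix.det_fin_two]
  rw [integral_sub (hint 0 0 1 1) (hint 0 1 1 0), heq, sub_self]

end NullLagrangian

/-! ### Hessian phases -/

/-- The open set on which the Hessian of `u` is locally constant with value `A`. -/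
def hessPhase (u : Plane → ℝ) (A : Mat) : Set Plane := {x | hess u =ᶠ[𝓝 x] fun _ => A}

theorem isOpen_hessPhase (u : Plane → ℝ) (A : Mat) : IsOpen (hessPhase u A) :=
  isOpen_setOfPred_eventually_nhds

theorem hess_eq_of_mem_hessPhase {u : Plane → ℝ} {x : Plane} {A : Mat} (h : x ∈ hessPhase u A) :
    hess u x = A := h.self_of_nhds

theorem mem_hessPhase_congr {u v : Plane → ℝ} {x : Plane} {A : Mat} (h : u =ᶠ[𝓝 x] v) :
    x ∈ hessPhase u A ↔ x ∈ hessPhase v A :=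
  ⟨(hess_congr h).symm.trans, (hess_congr h).trans⟩

theorem mem_hessPhase_add {u v : Plane → ℝ} {x : Plane} {A B : Mat}
    (hu : ContDiff ℝ (⊤ : ℕ∞) u) (hv : ContDiff ℝ (⊤ : ℕ∞) v) (hA : x ∈ hessPhase u A)
    (hB : x ∈ hessPhase v B) : x ∈ hessPhase (fun x => u x + v x) (A + B) := by
  rw [hessPhase, hess_add hu hv]
  exact hA.add hB

theorem mem_hessPhase_zero_of_notMem_tsupport {u : Plane → ℝ} {x : Plane} (hx : x ∉ tsupport u) :
    x ∈ hessPhase u 0 := by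
  refine (mem_hessPhase_congr (notMem_tsupport_iff_eventuallyEq.1 hx)).2 ?_
  exact Eventually.of_forall fun y => congrFun hess_zero y

theorem mem_hessPhase_comp_inner {w : ℝ → ℝ} (hw : ContDiff ℝ (⊤ : ℕ∞) w) {p x : Plane} {s : ℝ}
    (h : deriv (deriv w) =ᶠ[𝓝 (inner ℝ p x)] fun _ => s) :
    x ∈ hessPhase (fun x => w (inner ℝ p x)) (s • Matrix.vecMulVec p p) := by
  have hcont : Tendsto (fun y => inner ℝ p y) (𝓝 x) (𝓝 (inner ℝ p x)) :=
    (innerSL ℝ p).continuous.continuousAt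
  filter_upwards [hcont.eventually h] with y hy
  ext i j
  rw [hess_comp_inner_apply hw, hy, Matrix.smul_apply, Matrix.vecMulVec_apply, smul_eq_mul]

/-- Uniformly bounded Hessians of test functions can take, locally constantly, values in `S` off
sets of arbitrarily small measure. -/
def HasHessianPhases (S : Set Mat) : Prop :=
  ∃ C, ∀ κ > 0, ∃ φ : Test, (∀ x i j, |hess φ x i j| ≤ C) ∧
    (volume.restrict square).real (⋃ A ∈ S, hessPhase φ A)ᶜ ≤ κ

theorem hasHessianPhases_zero : HasHessianPhases {0} := by
  refine ⟨0, fun κ hκ => ⟨0, fun x i j => ?_, ?_⟩⟩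
  · rw [show hess (0 : Test) x = 0 from congrFun hess_zero x, Matrix.zero_apply, abs_zero]
  · have huniv : hessPhase (0 : Test) 0 = Set.univ :=
      Set.eq_univ_of_forall fun x => Eventually.of_forall fun y => congrFun hess_zero y
    rw [Set.biUnion_singleton, huniv, Set.compl_univ, measureReal_empty]
    exact hκ.le

open scoped Manifold in
theorem exists_cutoff {U : Set Plane} (hU : IsOpen U) {κ : ℝ} (hκ : 0 < κ) :
    ∃ η : Test, (∀ x, η x ∈ Set.Icc (0 : ℝ) 1) ∧ tsupport η ⊆ U ∧
      (volume.restrict square).real (U \ {x | η =ᶠ[𝓝 x] fun _ => 1}) ≤ κ := by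
  have hV : IsOpen (U ∩ interior square) := hU.inter isOpen_interior
  obtain ⟨K, hKV, hK, hKκ⟩ := hV.measurableSet.exists_isCompact_sdiff_lt
    (μ := volume.restrict square) (measure_ne_top _ _) (ENNReal.ofReal_pos.2 hκ).ne'
  obtain ⟨T, hT, hKT, hTV⟩ := exists_compact_between hK hV hKV
  obtain ⟨η, hη1, hη0, hη⟩ := exists_contMDiffMap_one_nhds_of_subset_interior (n := (⊤ : ℕ∞))
    𝓘(ℝ, Plane) hK.isClosed hKT
  have hsupp : tsupport η ⊆ T :=
    closure_minimal (fun x hx => not_not.1 fun h => hx (hη0 x h)) hT.isClosed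
  refine ⟨⟨η, η.contMDiff.contDiff, HasCompactSupport.of_support_subset_isCompact hT
    ((subset_tsupport _).trans hsupp), hsupp.trans (hTV.trans Set.inter_subset_right)⟩, hη,
    hsupp.trans (hTV.trans Set.inter_subset_left), ?_⟩
  have hinterior : ∀ᵐ x ∂(volume.restrict square), x ∈ interior square := by
    rw [← restrict_interior_square]
    exact ae_restrict_mem isOpen_interior.measurableSet
  refine ENNReal.toReal_le_of_le_ofReal hκ.le ((measure_mono_ae ?_).trans hKκ.le)
  filter_upwards [hinterior] with x hx hxU
  exact ⟨⟨hxU.1, hx⟩, fun hxK => hxU.2 (hη1.filter_mono (nhds_le_nhdsSet hxK))⟩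

theorem nullSingletonClass_map_inner {p : Plane} (hp : p ≠ 0) :
    NullSingletonClass ((volume.restrict square).map fun x => inner ℝ p x) := by
  refine ⟨fun r => ?_⟩
  have hmeas : Measurable fun x : Plane => inner ℝ p x := (innerSL ℝ p).continuous.measurable
  rw [Measure.map_apply hmeas (measurableSet_singleton r)]
  have hsurj : Function.Surjective (innerSL ℝ p : Plane →ₗ[ℝ] ℝ) :=
    LinearMap.surjective fun h => hp (inner_self_eq_zero.1
      (LinearMap.congr_fun h p : inner ℝ p p = 0))
  obtain ⟨c, -, hc⟩ := LinearMap.exists_map_addHaar_eq_smul_addHaar _ volume volume hsurj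
  have hnull := congrArg (fun m : Measure ℝ => m {r}) hc
  simp only [Measure.smul_apply, Real.volume_singleton, smul_zero] at hnull
  rw [Measure.map_apply (by exact hmeas) (measurableSet_singleton r)] at hnull
  exact le_antisymm ((Measure.restrict_apply_le _ _).trans hnull.le) zero_le

theorem abs_hess_mul_comp_inner_le {u : Plane → ℝ} (hu : ContDiff ℝ (⊤ : ℕ∞) u) {w : ℝ → ℝ}
    (hw : ContDiff ℝ (⊤ : ℕ∞) w) (p : Plane) {x : Plane} {C κ M : ℝ} (hux : |u x| ≤ 1)
    (hdu : ∀ i, |partialD i u x| ≤ C) (hhu : ∀ i j, |hess u x i j| ≤ C)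
    (hw0 : |w (inner ℝ p x)| ≤ κ) (hw1 : |deriv w (inner ℝ p x)| ≤ κ)
    (hw2 : |deriv (deriv w) (inner ℝ p x)| ≤ M) (i j : Fin 2) :
    |hess (fun x => u x * w (inner ℝ p x)) x i j| ≤ M * ‖p‖ ^ 2 + C * κ * (1 + 2 * ‖p‖) := by
  have hp (i : Fin 2) : |p i| ≤ ‖p‖ := PiLp.norm_apply_le p i
  have hC : 0 ≤ C := (abs_nonneg _).trans (hdu 0)
  have hκ : 0 ≤ κ := (abs_nonneg _).trans hw0
  have hM : 0 ≤ M := (abs_nonneg _).trans hw2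
  have hcross (k l : Fin 2) : |partialD k u x * deriv w (inner ℝ p x) * p l| ≤ C * κ * ‖p‖ := by
    rw [abs_mul, abs_mul]
    exact mul_le_mul (mul_le_mul (hdu k) hw1 (abs_nonneg _) hC) (hp l) (abs_nonneg _)
      (by positivity)
  have hmain : |u x * (deriv (deriv w) (inner ℝ p x) * (p i * p j))| ≤ 1 * (M * (‖p‖ * ‖p‖)) := by
    rw [abs_mul, abs_mul, abs_mul (p i)]
    gcongr <;> exact hp _
  have hlow : |hess u x i j * w (inner ℝ p x)| ≤ C * κ := by
    rw [abs_mul]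
    exact mul_le_mul (hhu i j) hw0 (abs_nonneg _) hC
  rw [hess_mul_comp_inner_apply hu hw]
  calc _ ≤ 1 * (M * (‖p‖ * ‖p‖)) + (C * κ + C * κ * ‖p‖ + C * κ * ‖p‖) :=
        (abs_add_le _ _).trans (add_le_add hmain ((abs_add_three _ _ _).trans
          (add_le_add (add_le_add hlow (hcross i j)) (hcross j i))))
    _ = _ := by ring

theorem exists_laminate {η : Test} (hη : ∀ x, η x ∈ Set.Icc (0 : ℝ) 1) {p : Plane} (hp : p ≠ 0)
    {s t : ℝ} (hst : s * t ≤ 0) {κ : ℝ} (hκ : 0 < κ) :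
    ∃ w : ℝ → ℝ, ContDiff ℝ (⊤ : ℕ∞) w ∧
      (∀ x i j, |hess (fun x => η x * w (inner ℝ p x)) x i j| ≤ (|s| + |t|) * ‖p‖ ^ 2 + 1) ∧
      (volume.restrict square).real
        (hessPhase (fun x => w (inner ℝ p x)) (s • Matrix.vecMulVec p p) ∪
          hessPhase (fun x => w (inner ℝ p x)) (t • Matrix.vecMulVec p p))ᶜ ≤ κ := by
  have hcont : Continuous fun x : Plane => inner ℝ p x := (innerSL ℝ p).continuous
  obtain ⟨C₁, hC₁⟩ := Test.exists_forall_abs_le η.partialD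
  obtain ⟨C₂, hC₂⟩ := η.exists_bound_hess
  obtain ⟨R, hR⟩ := η.hasCompactSupport.exists_bound_of_continuousOn hcont.continuousOn
  set C := max C₁ C₂
  set δ := C * (1 + 2 * ‖p‖)
  have hδ : 0 ≤ δ := mul_nonneg
    (((abs_nonneg _).trans (hC₁ 0 0)).trans (le_max_left _ _)) (by positivity)
  have := nullSingletonClass_map_inner hp
  obtain ⟨w, hw, hw0, hw1, hw2, hphases⟩ := exists_profile
    ((volume.restrict square).map fun x => inner ℝ p x) hst R
    (lt_min hκ (by positivity : 0 < 1 / (δ + 1)))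
  refine ⟨w, hw, fun x i j => ?_, ?_⟩
  · by_cases hx : x ∈ tsupport η
    · refine (abs_hess_mul_comp_inner_le η.contDiff hw p
        (abs_le.2 ⟨by linarith [(hη x).1], (hη x).2⟩)
        (fun i => (hC₁ i x).trans (le_max_left _ _))
        (fun i j => (hC₂ x i j).trans (le_max_right _ _))
        ((hw0 _ (hR x hx)).trans (min_le_right _ _))
        ((hw1 _).trans (min_le_right _ _)) (hw2 _) i j).trans ?_
      have hsmall : C * (1 / (δ + 1)) * (1 + 2 * ‖p‖) ≤ 1 := by
        rw [mul_right_comm, mul_one_div, div_le_one (by positivity)]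
        exact (lt_add_one δ).le
      gcongr
    · have hzero : hess (fun x => η x * w (inner ℝ p x)) x = 0 :=
        hess_eq_of_mem_hessPhase (mem_hessPhase_zero_of_notMem_tsupport fun h =>
          hx (tsupport_mul_subset_left h))
      rw [hzero, Matrix.zero_apply, abs_zero]
      positivity
  · refine le_trans (ENNReal.toReal_mono (measure_ne_top _ _) ?_) (hphases.trans (min_le_left _ _))
    refine (measure_mono fun x hx => ?_).trans
      (Measure.le_map_apply hcont.measurable.aemeasurable _)
    exact ⟨fun h => hx (Or.inl (mem_hessPhase_comp_inner hw h)),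
      fun h => hx (Or.inr (mem_hessPhase_comp_inner hw h))⟩

theorem mem_hessPhase_add_mul_comp_inner {φ η : Test} {w : ℝ → ℝ} (hw : ContDiff ℝ (⊤ : ℕ∞) w)
    {p x : Plane} {A B : Mat} (hA : x ∈ hessPhase φ A) (hη : η =ᶠ[𝓝 x] fun _ => 1)
    (hB : x ∈ hessPhase (fun x => w (inner ℝ p x)) B) :
    x ∈ hessPhase (fun x => φ x + η x * w (inner ℝ p x)) (A + B) := by
  refine mem_hessPhase_add φ.contDiff (η.contDiff.mul (contDiff_comp_inner hw p)) hA
    ((mem_hessPhase_congr ?_).2 hB)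
  filter_upwards [hη] with y hy
  rw [hy, one_mul]

theorem mem_hessPhase_add_mul_of_notMem_tsupport {φ η : Test} {u : Plane → ℝ}
    (hu : ContDiff ℝ (⊤ : ℕ∞) u) {x : Plane} {A : Mat} (hA : x ∈ hessPhase φ A)
    (hx : x ∉ tsupport η) : x ∈ hessPhase (fun x => φ x + η x * u x) A := by
  have hzero : x ∈ hessPhase (fun x => η x * u x) 0 :=
    mem_hessPhase_zero_of_notMem_tsupport fun h => hx (tsupport_mul_subset_left h)
  simpa only [add_zero] using mem_hessPhase_add φ.contDiff (η.contDiff.mul hu) hA hzero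

theorem compl_iUnion_hessPhase_subset {φ η : Test} {w : ℝ → ℝ} (hw : ContDiff ℝ (⊤ : ℕ∞) w)
    {p : Plane} {A B B' : Mat} {S : Set Mat} (hη : tsupport η ⊆ hessPhase φ A) :
    (⋃ X ∈ insert (A + B) (insert (A + B') S),
      hessPhase (fun x => φ x + η x * w (inner ℝ p x)) X)ᶜ ⊆
    (⋃ X ∈ insert A S, hessPhase φ X)ᶜ ∪ (hessPhase φ A \ {x | η =ᶠ[𝓝 x] fun _ => 1}) ∪
      (hessPhase (fun x => w (inner ℝ p x)) B ∪ hessPhase (fun x => w (inner ℝ p x)) B')ᶜ := by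
  intro x hx
  by_contra! hgood
  simp only [Set.mem_union, Set.mem_compl_iff, Set.mem_sdiff, not_or, not_not, not_and] at hgood
  obtain ⟨⟨hφx, hηx⟩, hwx⟩ := hgood
  refine hx ?_
  simp only [Set.biUnion_insert, Set.mem_union] at hφx ⊢
  by_cases hxA : x ∈ hessPhase φ A
  · exact (or_iff_not_imp_left.2 hwx).imp
      (mem_hessPhase_add_mul_comp_inner hw hxA (hηx hxA))
      fun hxB' => Or.inl (mem_hessPhase_add_mul_comp_inner hw hxA (hηx hxA) hxB')
  · obtain ⟨X, hXS, hxX⟩ := Set.mem_iUnion₂.1 (hφx.resolve_left hxA)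
    exact Or.inr (Or.inr (Set.mem_iUnion₂.2 ⟨X, hXS, mem_hessPhase_add_mul_of_notMem_tsupport
      (contDiff_comp_inner hw p) hxX fun h => hxA (hη h)⟩))

theorem HasHessianPhases.split {A : Mat} {S : Set Mat} (h : HasHessianPhases (insert A S))
    {p : Plane} (hp : p ≠ 0) {s t : ℝ} (hst : s * t ≤ 0) :
    HasHessianPhases (insert (A + s • Matrix.vecMulVec p p)
      (insert (A + t • Matrix.vecMulVec p p) S)) := by
  obtain ⟨C, hC⟩ := h
  refine ⟨C + ((|s| + |t|) * ‖p‖ ^ 2 + 1), fun κ hκ => ?_⟩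
  have hκ3 : 0 < κ / 3 := by positivity
  obtain ⟨φ, hφC, hφ⟩ := hC _ hκ3
  obtain ⟨η, hη, hsupp, hηκ⟩ := exists_cutoff (isOpen_hessPhase φ A) hκ3
  obtain ⟨w, hw, hwC, hwκ⟩ := exists_laminate hη hp hst hκ3
  have hwp := contDiff_comp_inner hw p
  refine ⟨φ + η.mulSmooth _ hwp, fun x i j => ?_, ?_⟩
  · change |hess (fun x => φ x + η x * w (inner ℝ p x)) x i j| ≤ _
    rw [hess_add φ.contDiff (η.contDiff.mul hwp)]
    exact (abs_add_le _ _).trans (add_le_add (hφC x i j) (hwC x i j))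
  · calc _ ≤ κ / 3 + κ / 3 + κ / 3 :=
          (measureReal_mono (compl_iUnion_hessPhase_subset hw hsupp)).trans
            ((measureReal_union_le _ _).trans
              (add_le_add ((measureReal_union_le _ _).trans (add_le_add hφ hηκ)) hwκ))
      _ = κ := by ring

/-- Affine functions plus multiples of the determinant: the functions on `2 × 2` matrices whose
integral against a Hessian depends only on the mean. -/
def IsQuasiaffine (g : Mat → ℝ) : Prop :=
  ∃ (L : Mat →ₗ[ℝ] ℝ) (c d : ℝ), ∀ X, g X = L X + c + d * X.det

theorem det_add_fin_two (ξ X : Mat) :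
    (ξ + X).det = ξ.det + (ξ.adjugate * X).trace + X.det := by
  simp only [Matrix.det_fin_two, Matrix.adjugate_fin_two, Matrix.trace_fin_two, Matrix.mul_apply,
    Fin.sum_univ_two, Matrix.add_apply, Matrix.of_apply, Matrix.cons_val_zero,
    Matrix.cons_val_one]
  ring

theorem linearMap_apply_eq_sum {R m n : Type*} [CommSemiring R] [Fintype m] [Fintype n]
    [DecidableEq m] [DecidableEq n] (L : Matrix m n R →ₗ[R] R) (X : Matrix m n R) :
    L X = ∑ i, ∑ j, X i j * L (Matrix.single i j 1) := by
  conv_lhs => rw [Matrix.matrix_eq_sum_single X]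
  simp only [map_sum, ← smul_eq_mul (a := X _ _), ← map_smul, Matrix.smul_single]
  simp only [smul_eq_mul, mul_one]

theorem integrable_linearMap_hess (L : Mat →ₗ[ℝ] ℝ) {φ : Plane → ℝ} {G : Fin 2 → Plane → ℝ}
    {H : Plane → Mat} (h : IsW2Infty φ G H) :
    Integrable (fun x => L (H x)) (volume.restrict square) := by
  rw [funext fun x => linearMap_apply_eq_sum L (H x)]
  exact integrable_finsetSum _ fun i _ => integrable_finsetSum _ fun j _ =>
    ((h.bounded_hess i j).integrable le_top).mul_const _

theorem integral_linearMap_hess_eq_zero (L : Mat →ₗ[ℝ] ℝ) {φ : Plane → ℝ}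
    {G : Fin 2 → Plane → ℝ} {H : Plane → Mat} (h : IsW2InftyZero φ G H) :
    ∫ x in square, L (H x) = 0 := by
  have hint (i j : Fin 2) : Integrable (fun x => H x i j * L (Matrix.single i j 1))
      (volume.restrict square) := ((h.1.bounded_hess i j).integrable le_top).mul_const _
  rw [funext fun x => linearMap_apply_eq_sum L (H x),
    integral_finsetSum _ fun i _ => integrable_finsetSum _ fun j _ => hint i j]
  simp only [integral_finsetSum _ fun j _ => hint _ j, integral_mul_const,
    integral_hess_eq_zero h, zero_mul, Finset.sum_const_zero]

namespace IsQuasiaffine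

variable {g : Mat → ℝ}

theorem continuous (hg : IsQuasiaffine g) : Continuous g := by
  obtain ⟨L, c, d, hg⟩ := hg
  have hL : Continuous L := L.continuous_of_finiteDimensional
  rw [funext hg]
  fun_prop

theorem const_mul (hg : IsQuasiaffine g) (k : ℝ) : IsQuasiaffine fun X => k * g X := by
  obtain ⟨L, c, d, hg⟩ := hg
  refine ⟨k • L, k * c, k * d, fun X => ?_⟩
  simp only [hg, LinearMap.smul_apply, smul_eq_mul]
  ring

theorem comp_const_add (hg : IsQuasiaffine g) (ξ : Mat) : IsQuasiaffine fun X => g (ξ + X) := by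
  obtain ⟨L, c, d, hg⟩ := hg
  refine ⟨L + d • (Matrix.traceLinearMap (Fin 2) ℝ ℝ ∘ₗ LinearMap.mulLeft ℝ ξ.adjugate),
    L ξ + c + d * ξ.det, d, fun X => ?_⟩
  simp only [hg, map_add, det_add_fin_two, LinearMap.add_apply, LinearMap.smul_apply,
    LinearMap.comp_apply, LinearMap.mulLeft_apply, Matrix.traceLinearMap_apply, smul_eq_mul]
  ring

theorem comp_congruence (hg : IsQuasiaffine g) (N : Mat) :
    IsQuasiaffine fun X => g (N * X * N.transpose) := by
  obtain ⟨L, c, d, hg⟩ := hg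
  refine ⟨L ∘ₗ LinearMap.mulRight ℝ N.transpose ∘ₗ LinearMap.mulLeft ℝ N, c, d * N.det ^ 2,
    fun X => ?_⟩
  simp only [hg, LinearMap.comp_apply, LinearMap.mulLeft_apply, LinearMap.mulRight_apply,
    Matrix.det_mul, Matrix.det_transpose]
  ring

variable {φ : Plane → ℝ} {G : Fin 2 → Plane → ℝ} {H : Plane → Mat}

theorem integrable (hg : IsQuasiaffine g) (h : IsW2Infty φ G H) :
    Integrable (fun x => g (H x)) (volume.restrict square) := by
  obtain ⟨L, c, d, hg⟩ := hg
  simp only [hg]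
  exact ((integrable_linearMap_hess L h).add (integrable_const c)).add
    (((memLp_det_hess h).integrable le_top).const_mul d)

theorem integral_eq (hg : IsQuasiaffine g) (h : IsW2InftyZero φ G H) :
    ∫ x in square, g (H x) = g 0 := by
  obtain ⟨L, c, d, hg⟩ := hg
  have hL := integrable_linearMap_hess L h.1
  have hdet := ((memLp_det_hess h.1).integrable le_top).const_mul d
  simp only [hg]
  rw [integral_add (hL.fun_add (integrable_const c)) hdet, integral_add hL (integrable_const c),
    integral_linearMap_hess_eq_zero L h, integral_const_mul, integral_det_hess_eq_zero h]
  simp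

end IsQuasiaffine

/-! ### Quasiconvexification of functions with a quasiaffine minorant -/

instance : MeasurableSpace Mat := borel Mat

instance : BorelSpace Mat := ⟨rfl⟩

theorem aemeasurable_of_entries {X : Type*} [MeasurableSpace X] {μ : Measure X} {H : X → Mat}
    (hH : ∀ i j, AEMeasurable (fun x => H x i j) μ) : AEMeasurable H μ := by
  have hof : Continuous fun e : Fin 2 → Fin 2 → ℝ => (Matrix.of e : Mat) := continuous_id
  exact hof.measurable.comp_aemeasurable
    (aemeasurable_pi_iff.2 fun i => aemeasurable_pi_iff.2 fun j => hH i j)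

theorem exists_forall_le_of_abs_entries_le {h : Mat → ℝ} (hh : Continuous h) (C : ℝ) :
    ∃ D, ∀ X : Mat, (∀ i j, |X i j| ≤ C) → h X ≤ D := by
  have hK : IsCompact (Set.univ.pi fun _ : Fin 2 => Set.univ.pi fun _ : Fin 2 => Set.Icc (-C) C) :=
    isCompact_univ_pi fun _ => isCompact_univ_pi fun _ => isCompact_Icc
  obtain ⟨D, hD⟩ := (hK.image (f := fun X => h (Matrix.of X)) hh).bddAbove
  exact ⟨D, fun X hX => hD ⟨X, fun i _ j _ => abs_le.1 (hX i j), rfl⟩⟩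

section Quasiconvexification

variable {f h g : Mat → ℝ} {ξ : Mat} {φ : Plane → ℝ} {G : Fin 2 → Plane → ℝ} {H : Plane → Mat}

theorem integrable_comp_hess (hf : Measurable f) (hh : Continuous h) (hfh : ∀ X, |f X| ≤ h X)
    (hW : IsW2Infty φ G H) (ξ : Mat) :
    Integrable (fun x => f (ξ + H x)) (volume.restrict square) := by
  have hH : AEMeasurable H (volume.restrict square) :=
    aemeasurable_of_entries fun i j => (hW.bounded_hess i j).aestronglyMeasurable.aemeasurable
  have hf' : Measurable fun X => f (ξ + X) := hf.comp (continuous_const_add ξ).measurable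
  obtain ⟨C, hC⟩ := Finite.exists_le fun k : Fin 2 × Fin 2 =>
    lpNorm (fun x => H x k.1 k.2) ∞ (volume.restrict square)
  obtain ⟨D, hD⟩ := exists_forall_le_of_abs_entries_le (hh.comp (continuous_const_add ξ)) C
  refine Integrable.of_bound (hf'.comp_aemeasurable hH).aestronglyMeasurable D ?_
  have hentries (i j : Fin 2) : ∀ᵐ x ∂(volume.restrict square), |H x i j| ≤ C := by
    filter_upwards [ae_le_lpNorm_exponent_top (hW.bounded_hess i j)] with x hx
    exact hx.trans (hC (i, j))
  filter_upwards [ae_all_iff.2 fun i => ae_all_iff.2 (hentries i)] with x hx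
  exact (hfh _).trans (hD _ hx)

theorem le_quasiconvexification (hξ : ξ.IsSymm) (hf : Measurable f) (hh : Continuous h)
    (hfh : ∀ X, |f X| ≤ h X) (hg : IsQuasiaffine g) (hgf : ∀ X : Mat, X.IsSymm → g X ≤ f X) :
    (g ξ : EReal) ≤ quasiconvexification f ξ := by
  refine le_iInf fun φ => le_iInf fun G => le_iInf fun H => le_iInf fun hφ => ?_
  have hgξ := hg.comp_const_add ξ
  rw [EReal.coe_le_coe_iff, ← add_zero ξ, ← hgξ.integral_eq hφ]
  refine integral_mono_ae (hgξ.integrable hφ.1)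
    (by simpa only [add_zero] using integrable_comp_hess hf hh hfh hφ.1 ξ) ?_
  filter_upwards [isSymm_hess_ae hφ] with x hx
  simpa only [add_zero] using hgf _ (hξ.add hx)

theorem exists_test_integral_le (hf : Measurable f) (hh : Continuous h)
    (hfh : ∀ X, |f X| ≤ h X) (hg : IsQuasiaffine g) {S : Set Mat} (hS : HasHessianPhases S)
    (hfg : ∀ A ∈ S, f (ξ + A) = g (ξ + A)) {ε : ℝ} (hε : 0 < ε) :
    ∃ φ : Test, ∫ x in square, f (ξ + hess φ x) ≤ g ξ + ε := by
  obtain ⟨C, hC⟩ := hS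
  have hgξ := hg.comp_const_add ξ
  obtain ⟨D, hD⟩ := exists_forall_le_of_abs_entries_le
    ((hh.comp (continuous_const_add ξ)).sub hgξ.continuous) C
  obtain ⟨φ, hφC, hφ⟩ := hC (ε / (|D| + 1)) (by positivity)
  refine ⟨φ, ?_⟩
  set bad := (⋃ A ∈ S, hessPhase φ A)ᶜ
  have hbad : MeasurableSet bad :=
    (isOpen_biUnion fun A _ => isOpen_hessPhase φ A).measurableSet.compl
  have hle (x : Plane) : f (ξ + hess φ x) ≤ g (ξ + hess φ x) + bad.indicator (fun _ => |D|) x := by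
    by_cases hx : x ∈ bad
    · rw [Set.indicator_of_mem hx]
      have hfx := (le_abs_self _).trans (hfh (ξ + hess φ x))
      have hDx : h (ξ + hess φ x) - g (ξ + hess φ x) ≤ D := hD _ (hφC x)
      linarith [le_abs_self D]
    · obtain ⟨A, hA, hxA⟩ := Set.mem_iUnion₂.1 (not_not.1 hx)
      have hφx : hess φ x = A := hess_eq_of_mem_hessPhase hxA
      rw [Set.indicator_of_notMem hx, add_zero, hφx, hfg A hA]
  have hint : Integrable (bad.indicator fun _ => |D|) (volume.restrict square) :=
    (integrable_const _).indicator hbad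
  have hadm := φ.isW2InftyZero
  calc ∫ x in square, f (ξ + hess φ x)
      ≤ ∫ x in square, (g (ξ + hess φ x) + bad.indicator (fun _ => |D|) x) :=
        integral_mono (integrable_comp_hess hf hh hfh hadm.1 ξ)
          ((hgξ.integrable hadm.1).add hint) hle
    _ = g ξ + (volume.restrict square).real bad * |D| := by
        rw [integral_add (hgξ.integrable hadm.1) hint, hgξ.integral_eq hadm, add_zero,
          integral_indicator_const _ hbad, smul_eq_mul]
    _ ≤ g ξ + ε / (|D| + 1) * (|D| + 1) := by
        gcongr
        exact (lt_add_one _).le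
    _ = g ξ + ε := by rw [div_mul_cancel₀ _ (by positivity)]

theorem quasiconvexification_eq (hξ : ξ.IsSymm) (hf : Measurable f) (hh : Continuous h)
    (hfh : ∀ X, |f X| ≤ h X) (hg : IsQuasiaffine g) (hgf : ∀ X : Mat, X.IsSymm → g X ≤ f X)
    {S : Set Mat} (hS : HasHessianPhases S) (hfg : ∀ A ∈ S, f (ξ + A) = g (ξ + A)) :
    quasiconvexification f ξ = g ξ := by
  refine le_antisymm (EReal.le_of_forall_lt_iff_le.1 fun z hz => ?_)
    (le_quasiconvexification hξ hf hh hfh hg hgf)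
  obtain ⟨φ, hφ⟩ := exists_test_integral_le hf hh hfh hg hS hfg
    (sub_pos.2 (EReal.coe_lt_coe_iff.1 hz))
  refine iInf_le_of_le φ (iInf_le_of_le _ (iInf_le_of_le _ (iInf_le_of_le φ.isW2InftyZero ?_)))
  exact EReal.coe_le_coe_iff.2 (hφ.trans_eq (add_sub_cancel _ _))

end Quasiconvexification

/-! ### The relaxed density -/

theorem frobSq_eq_trace (A : Mat) : frobSq A = (A.transpose * A).trace := by
  simp only [frobSq, Matrix.trace, Matrix.diag_apply, Matrix.mul_apply, Matrix.transpose_apply, sq]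
  exact Finset.sum_comm

theorem frobSq_diagonal (d : Fin 2 → ℝ) : frobSq (Matrix.diagonal d) = ∑ i, d i ^ 2 := by
  rw [frobSq_eq_trace, Matrix.diagonal_transpose, Matrix.diagonal_mul_diagonal,
    Matrix.trace_diagonal]
  simp only [sq]

theorem frobSq_orthogonal_conj {U : Mat} (hU : U * U.transpose = 1) (A : Mat) :
    frobSq (U.transpose * A * U) = frobSq A := by
  have hcancel : (U.transpose * A * U).transpose * (U.transpose * A * U) =
      U.transpose * (A.transpose * A * U) := by
    simp only [Matrix.transpose_mul, Matrix.transpose_transpose, Matrix.mul_assoc]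
    rw [← Matrix.mul_assoc U, hU, Matrix.one_mul]
  rw [frobSq_eq_trace, frobSq_eq_trace, hcancel, Matrix.trace_mul_comm, Matrix.mul_assoc, hU,
    Matrix.mul_one]

theorem frobSq_eq_zero_iff {A : Mat} : frobSq A = 0 ↔ A = 0 := by
  rw [frobSq_eq_trace, ← Matrix.conjTranspose_eq_transpose_of_trivial,
    Matrix.trace_conjTranspose_mul_self_eq_zero_iff]

theorem bigF_orthogonal_conj (lam : ℝ) {U : Mat} (hU : U * U.transpose = 1) (A : Mat) :
    bigF lam (U.transpose * A * U) = bigF lam A := by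
  simp only [bigF, ← frobSq_eq_zero_iff, frobSq_orthogonal_conj hU]

theorem continuous_frobSq : Continuous frobSq := by
  unfold frobSq
  fun_prop

theorem measurable_bigF (lam : ℝ) : Measurable (bigF lam) :=
  Measurable.ite (measurableSet_singleton 0) measurable_const
    (continuous_frobSq.measurable.add_const lam)

theorem abs_bigF_le (lam : ℝ) (A : Mat) : |bigF lam A| ≤ frobSq A + |lam| := by
  have hnonneg : 0 ≤ frobSq A :=
    Finset.sum_nonneg fun i _ => Finset.sum_nonneg fun j _ => sq_nonneg (A i j)
  rw [bigF]
  split_ifs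
  · rw [abs_zero]
    positivity
  · exact (abs_add_le _ _).trans_eq (by rw [abs_of_nonneg hnonneg])

/-- The quasiaffine minorant of `F_λ` with slope `m` and signs `σᵢ`: for symmetric `A ≠ 0`, it is
`F_λ(A) - (∑ᵢ σᵢ Aᵢᵢ - m)² - 2 (1 - σ₀ σ₁) A₀₁²`. -/
def minorant (lam m : ℝ) (σ : Fin 2 → ℝ) (A : Mat) : ℝ :=
  2 * m * ∑ i, σ i * A i i - m ^ 2 + lam - 2 * (∏ i, σ i) * A.det

theorem isQuasiaffine_minorant (lam m : ℝ) (σ : Fin 2 → ℝ) :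
    IsQuasiaffine (minorant lam m σ) := by
  refine ⟨(2 * m) • (Matrix.traceLinearMap (Fin 2) ℝ ℝ ∘ₗ LinearMap.mulLeft ℝ (Matrix.diagonal σ)),
    lam - m ^ 2, -2 * ∏ i, σ i, fun A => ?_⟩
  simp only [minorant, LinearMap.smul_apply, LinearMap.comp_apply, LinearMap.mulLeft_apply,
    Matrix.traceLinearMap_apply, Matrix.trace, Matrix.diag_apply, Matrix.diagonal_mul, smul_eq_mul]
  ring

section Minorant

variable {lam m : ℝ} {σ d : Fin 2 → ℝ}

theorem minorant_le_bigF (hm : lam ≤ m ^ 2) (hσ : ∀ i, σ i ^ 2 = 1) {A : Mat} (hA : A.IsSymm) :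
    minorant lam m σ A ≤ bigF lam A := by
  rw [bigF]
  split_ifs with h
  · simp only [h, minorant, Matrix.zero_apply, mul_zero, Finset.sum_const_zero, Matrix.det_zero,
      sub_zero, zero_sub]
    linarith
  · have hsigns : σ 0 * σ 1 ≤ 1 := by
      linarith [sq_nonneg (σ 0 - σ 1), sub_sq (σ 0) (σ 1), hσ 0, hσ 1]
    have hsq := sq_nonneg (σ 0 * A 0 0 + σ 1 * A 1 1 - m)
    have hoff := mul_nonneg (sub_nonneg.2 hsigns) (sq_nonneg (A 0 1))
    rw [← sub_nonneg]
    refine (add_nonneg hsq (mul_nonneg zero_le_two hoff)).trans_eq ?_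
    simp only [frobSq, minorant, Matrix.det_fin_two, Fin.sum_univ_two, Fin.prod_univ_two,
      hA.apply 0 1]
    linear_combination A 0 0 ^ 2 * hσ 0 + A 1 1 ^ 2 * hσ 1

theorem minorant_diagonal : minorant lam m σ (Matrix.diagonal d) =
    2 * m * ∑ i, σ i * d i - m ^ 2 + lam - 2 * ∏ i, σ i * d i := by
  simp only [minorant, Matrix.diagonal_apply_eq, Matrix.det_diagonal, Finset.prod_mul_distrib]
  ring

theorem bigF_diagonal_eq_minorant (hσ : ∀ i, σ i ^ 2 = 1) (hm : m ≠ 0)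
    (hd : ∑ i, σ i * d i = m) :
    bigF lam (Matrix.diagonal d) = minorant lam m σ (Matrix.diagonal d) := by
  have hne : Matrix.diagonal d ≠ 0 := by
    intro h
    rw [Matrix.diagonal_eq_zero] at h
    exact hm (by simp only [← hd, h, Pi.zero_apply, mul_zero, Finset.sum_const_zero])
  rw [bigF, if_neg hne, frobSq_diagonal, minorant_diagonal, hd, ← hd]
  simp only [Fin.sum_univ_two, Fin.prod_univ_two]
  linear_combination -d 0 ^ 2 * hσ 0 - d 1 ^ 2 * hσ 1

theorem bigF_zero_eq_minorant (hm : m ^ 2 = lam) : bigF lam 0 = minorant lam m σ 0 := by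
  simp [bigF, minorant, hm]

end Minorant

theorem sum_smul_vecMulVec_col {R m n : Type*} [CommSemiring R] [Fintype n] [DecidableEq n]
    (P : Matrix m n R) (a : n → R) :
    ∑ k, a k • Matrix.vecMulVec (P.col k) (P.col k) = P * Matrix.diagonal a * P.transpose := by
  ext i j
  simp only [Matrix.sum_apply, Matrix.smul_apply, Matrix.vecMulVec_apply, Matrix.col_apply,
    smul_eq_mul]
  rw [Matrix.mul_apply]
  exact Finset.sum_congr rfl fun k _ => by rw [Matrix.mul_diagonal, Matrix.transpose_apply]; ring

theorem congr_add_inv_congr_diagonal {R n : Type*} [CommRing R] [Fintype n] [DecidableEq n]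
    {N ξ : Matrix n n R} (hN : IsUnit N.det) {d : n → R}
    (hd : N * ξ * N.transpose = Matrix.diagonal d) (a : n → R) :
    N * (ξ + N⁻¹ * Matrix.diagonal a * N⁻¹.transpose) * N.transpose =
      Matrix.diagonal (d + a) := by
  have hcancel : N * (N⁻¹ * Matrix.diagonal a * N⁻¹.transpose) * N.transpose =
      Matrix.diagonal a := by
    rw [Matrix.mul_assoc N⁻¹, Matrix.mul_nonsing_inv_cancel_left _ _ hN, Matrix.mul_assoc,
      ← Matrix.transpose_mul, Matrix.mul_nonsing_inv _ hN, Matrix.transpose_one, Matrix.mul_one]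
  rw [Matrix.mul_add, Matrix.add_mul, hd, hcancel]
  exact Matrix.diagonal_add d a

theorem hasHessianPhases_congr_diagonal {P : Mat} (hP : IsUnit P.det) {s₀ t₀ s₁ t₁ : ℝ}
    (h₀ : s₀ * t₀ ≤ 0) (h₁ : s₁ * t₁ ≤ 0) :
    HasHessianPhases ((fun a : Fin 2 → ℝ => P * Matrix.diagonal a * P.transpose) ''
      {![t₀, s₁], ![t₀, t₁], ![s₀, 0]}) := by
  have hcol (k : Fin 2) : WithLp.toLp 2 (P.col k) ≠ 0 := by
    intro h
    exact hP.ne_zero (Matrix.det_eq_zero_of_column_eq_zero k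
      (congrFun ((WithLp.toLp_eq_zero 2).1 h)))
  have hsplit : HasHessianPhases (insert 0 ∅) := by
    simpa only [insert_empty_eq] using hasHessianPhases_zero
  have h := hsplit.split (hcol 0) h₀
  rw [Set.insert_comm] at h
  simpa [Set.image_insert_eq, ← sum_smul_vecMulVec_col] using h.split (hcol 1) h₁

/-- The relaxation of `F_λ` at a diagonal matrix with entries `dᵢ`. -/
def relaxed (lam : ℝ) (d : Fin 2 → ℝ) : ℝ :=
  if ∑ i, |d i| ≤ √lam then 2 * √lam * ∑ i, |d i| - 2 * |∏ i, d i| else ∑ i, d i ^ 2 + lam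

theorem exists_sq_eq_one_and_mul_eq_abs (a : ℝ) : ∃ σ : ℝ, σ ^ 2 = 1 ∧ σ * a = |a| := by
  rcases abs_choice a with h | h
  · exact ⟨1, one_pow 2, by rw [one_mul, h]⟩
  · exact ⟨-1, neg_one_sq, by rw [neg_one_mul, h]⟩

section Relaxation

variable {lam k : ℝ} {N ξ : Mat} {d : Fin 2 → ℝ}

theorem measurable_const_mul_bigF_congr (lam k : ℝ) (N : Mat) :
    Measurable fun X : Mat => k * bigF lam (N * X * N.transpose) :=
  ((measurable_bigF lam).comp (by fun_prop : Continuous fun X : Mat =>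
    N * X * N.transpose).measurable).const_mul k

theorem exists_continuous_bound_const_mul_bigF_congr (lam k : ℝ) (N : Mat) :
    ∃ h : Mat → ℝ, Continuous h ∧ ∀ X, |k * bigF lam (N * X * N.transpose)| ≤ h X := by
  refine ⟨fun X => |k| * (frobSq (N * X * N.transpose) + |lam|), ?_, fun X => ?_⟩
  · have := continuous_frobSq
    fun_prop
  · rw [abs_mul]
    exact mul_le_mul_of_nonneg_left (abs_bigF_le lam _) (abs_nonneg k)

theorem integrable_const_mul_bigF_congr {φ : Plane → ℝ} {G : Fin 2 → Plane → ℝ} {H : Plane → Mat}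
    (hW : IsW2Infty φ G H) (lam k : ℝ) (N ξ : Mat) :
    Integrable (fun x => k * bigF lam (N * (ξ + H x) * N.transpose)) (volume.restrict square) := by
  obtain ⟨h, hh, hle⟩ := exists_continuous_bound_const_mul_bigF_congr lam k N
  exact integrable_comp_hess (measurable_const_mul_bigF_congr lam k N) hh hle hW ξ

theorem quasiconvexification_eq_minorant (hk : 0 ≤ k) {m : ℝ} (hm : lam ≤ m ^ 2)
    {σ : Fin 2 → ℝ} (hσ : ∀ i, σ i ^ 2 = 1) (hξ : ξ.IsSymm) {S : Set Mat}
    (hS : HasHessianPhases S) (hphase : ∀ A ∈ S, bigF lam (N * (ξ + A) * N.transpose) =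
      minorant lam m σ (N * (ξ + A) * N.transpose)) :
    quasiconvexification (fun X => k * bigF lam (N * X * N.transpose)) ξ =
      (k * minorant lam m σ (N * ξ * N.transpose) : ℝ) := by
  obtain ⟨h, hh, hle⟩ := exists_continuous_bound_const_mul_bigF_congr lam k N
  refine quasiconvexification_eq hξ (measurable_const_mul_bigF_congr lam k N) hh hle
    (((isQuasiaffine_minorant lam m σ).comp_congruence N).const_mul k) (fun X hX => ?_) hS
    fun A hA => congrArg (k * ·) (hphase A hA)
  have hsymm : (N * X * N.transpose).IsSymm := by
    rw [Matrix.IsSymm, Matrix.transpose_mul, Matrix.transpose_mul, Matrix.transpose_transpose,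
      hX.eq, Matrix.mul_assoc]
  exact mul_le_mul_of_nonneg_left (minorant_le_bigF hm hσ hsymm) hk

theorem quasiconvexification_eq_of_sqrt_lt (hk : 0 ≤ k) (hξ : ξ.IsSymm)
    (hd : N * ξ * N.transpose = Matrix.diagonal d) (hlam : √lam < ∑ i, |d i|) :
    quasiconvexification (fun X => k * bigF lam (N * X * N.transpose)) ξ =
      (k * (∑ i, d i ^ 2 + lam) : ℝ) := by
  choose σ hσ hσd using fun i => exists_sq_eq_one_and_mul_eq_abs (d i)
  have hpos : 0 < ∑ i, |d i| := (Real.sqrt_nonneg lam).trans_lt hlam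
  have hsum : ∑ i, σ i * d i = ∑ i, |d i| := Finset.sum_congr rfl fun i _ => hσd i
  have hvalue := bigF_diagonal_eq_minorant (lam := lam) hσ hpos.ne' hsum
  rw [quasiconvexification_eq_minorant hk ((Real.sqrt_lt' hpos).1 hlam).le hσ hξ
    hasHessianPhases_zero (by simpa [hd] using hvalue), hd, ← hvalue, bigF, if_neg, frobSq_diagonal]
  rw [Matrix.diagonal_eq_zero]
  rintro rfl
  simp at hpos

theorem quasiconvexification_eq_of_le_sqrt (hlam : 0 < lam) (hk : 0 ≤ k) (hN : IsUnit N.det)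
    (hξ : ξ.IsSymm) (hd : N * ξ * N.transpose = Matrix.diagonal d) (hle : ∑ i, |d i| ≤ √lam) :
    quasiconvexification (fun X => k * bigF lam (N * X * N.transpose)) ξ =
      (k * (2 * √lam * ∑ i, |d i| - 2 * |∏ i, d i|) : ℝ) := by
  choose σ hσ hσd using fun i => exists_sq_eq_one_and_mul_eq_abs (d i)
  have hr : 0 < √lam := Real.sqrt_pos.2 hlam
  rw [Fin.sum_univ_two] at hle
  -- laminate `d` between `(σ₀ (√λ - |d₁|), d₁)` and `(0, d₁)`, then `(0, d₁)` between
  -- `(0, 0)` and `(0, σ₁ √λ)`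
  have hfirst : (σ 0 * (√lam - |d 1|) - d 0) * -d 0 ≤ 0 := by
    have := mul_nonneg (abs_nonneg (d 0)) (by linarith : 0 ≤ √lam - |d 1| - |d 0|)
    linear_combination this - (√lam - |d 1|) * hσd 0 - sq_abs (d 0)
  have hsecond : -d 1 * (σ 1 * √lam - d 1) ≤ 0 := by
    have := mul_nonneg (abs_nonneg (d 1)) (by linarith [abs_nonneg (d 0)] : 0 ≤ √lam - |d 1|)
    linear_combination this - √lam * hσd 1 - sq_abs (d 1)
  have hP : IsUnit N⁻¹.det := (Matrix.isUnit_nonsing_inv_det N hN)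
  rw [quasiconvexification_eq_minorant (σ := σ) hk (Real.sq_sqrt hlam.le).ge hσ hξ
    (hasHessianPhases_congr_diagonal hP hfirst hsecond), hd, minorant_diagonal]
  · simp only [hσd, Real.sq_sqrt hlam.le, Finset.abs_prod]
    congr 2
    ring
  · rintro - ⟨a, ha, rfl⟩
    rw [congr_add_inv_congr_diagonal hN hd]
    rcases ha with rfl | rfl | rfl
    · rw [show d + ![-d 0, -d 1] = 0 by ext i; fin_cases i <;> simp, Matrix.diagonal_zero']
      exact bigF_zero_eq_minorant (Real.sq_sqrt hlam.le)
    · refine bigF_diagonal_eq_minorant hσ hr.ne' ?_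
      simp only [Fin.sum_univ_two, Pi.add_apply, Matrix.cons_val_zero, Matrix.cons_val_one]
      linear_combination √lam * hσ 1
    · refine bigF_diagonal_eq_minorant hσ hr.ne' ?_
      simp only [Fin.sum_univ_two, Pi.add_apply, Matrix.cons_val_zero, Matrix.cons_val_one]
      linear_combination (√lam - |d 1|) * hσ 0 + hσd 1

theorem quasiconvexification_const_mul_bigF_congr (hlam : 0 < lam) (hk : 0 ≤ k)
    (hN : IsUnit N.det) (hξ : ξ.IsSymm) (hd : N * ξ * N.transpose = Matrix.diagonal d) :
    quasiconvexification (fun X => k * bigF lam (N * X * N.transpose)) ξ =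
      (k * relaxed lam d : ℝ) := by
  rw [relaxed]
  split_ifs with h
  · exact quasiconvexification_eq_of_le_sqrt hlam hk hN hξ hd h
  · exact quasiconvexification_eq_of_sqrt_lt hk hξ hd (not_le.1 h)

end Relaxation

/-! ### The shape operator -/

theorem posDef_metric (v : Plane) : (metric v).PosDef := by
  have hrank_one : metric v = 1 + Matrix.vecMulVec (v : Fin 2 → ℝ) (star (v : Fin 2 → ℝ)) := by
    rw [star_trivial]
    rfl
  rw [hrank_one]
  exact Matrix.PosDef.one.add_posSemidef (Matrix.posSemidef_vecMulVec_self_star _)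

theorem isUnit_metricInvSqrt (v : Plane) : IsUnit (metricInvSqrt v) := by
  have hsa : IsSelfAdjoint (metric v) := (posDef_metric v).isHermitian
  have hspec : ∀ t ∈ spectrum ℝ (metric v), 0 < t := by
    rw [(posDef_metric v).isHermitian.spectrum_real_eq_range_eigenvalues]
    rintro - ⟨i, rfl⟩
    exact (posDef_metric v).eigenvalues_pos i
  refine (isUnit_cfc_iff _ _ (fun t ht => ?_) hsa).2 fun t ht =>
    (Real.rpow_pos_of_pos (hspec t ht) _).ne'
  exact (Real.continuousAt_rpow_const t _ (Or.inl (hspec t ht).ne')).continuousWithinAt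

theorem isSymm_metricInvSqrt (v : Plane) : (metricInvSqrt v).IsSymm := by
  have h : IsSelfAdjoint (metricInvSqrt v) := cfc_predicate _ _
  rw [Matrix.IsSymm, ← Matrix.conjTranspose_eq_transpose_of_trivial]
  exact h

/-- The matrix `M` for which `S(v, ξ) = M ξ Mᵀ`. -/
def shapeFactor (v : Plane) : Mat := √(1 / √(1 + ‖v‖ ^ 2)) • metricInvSqrt v

theorem shape_eq_shapeFactor_congr (v : Plane) (X : Mat) :
    shape v X = shapeFactor v * X * (shapeFactor v).transpose := by
  simp only [shape, secondForm, shapeFactor, Matrix.transpose_smul, (isSymm_metricInvSqrt v).eq,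
    Matrix.smul_mul, Matrix.mul_smul, smul_smul]
  rw [Real.mul_self_sqrt (by positivity)]

theorem isUnit_det_shapeFactor (v : Plane) : IsUnit (shapeFactor v).det := by
  have hdet := (Matrix.isUnit_iff_isUnit_det _).1 (isUnit_metricInvSqrt v)
  have hscale : √(1 / √(1 + ‖v‖ ^ 2)) ≠ 0 := by positivity
  rw [shapeFactor, Matrix.det_smul]
  exact ((isUnit_iff_ne_zero.2 hscale).pow _).mul hdet

theorem exists_orthogonal_diagonalization {n : Type*} [Fintype n] [DecidableEq n]
    {A : Matrix n n ℝ} (hA : A.IsHermitian) :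
    ∃ U : Matrix n n ℝ, U * U.transpose = 1 ∧
      U.transpose * A * U = Matrix.diagonal hA.eigenvalues := by
  refine ⟨hA.eigenvectorUnitary, ?_, ?_⟩
  · rw [← Matrix.conjTranspose_eq_transpose_of_trivial]
    exact Unitary.coe_mul_star_self hA.eigenvectorUnitary
  · have h := hA.conjStarAlgAut_star_eigenvectorUnitary
    rw [Unitary.conjStarAlgAut_apply, Unitary.coe_star, star_star, Matrix.star_eq_conjTranspose,
      Matrix.conjTranspose_eq_transpose_of_trivial] at h
    exact h

theorem frobSq_eq_sum_sq_eigenvalues {A : Mat} (hA : A.IsHermitian) :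
    frobSq A = ∑ i, hA.eigenvalues i ^ 2 := by
  obtain ⟨U, hU, hdiag⟩ := exists_orthogonal_diagonalization hA
  rw [← frobSq_orthogonal_conj hU, hdiag, frobSq_diagonal]

theorem relaxed_eigenvalues (lam : ℝ) {A : Mat} (hA : A.IsHermitian) :
    relaxed lam hA.eigenvalues =
      if rho A hA ≤ √lam then 2 * √lam * rho A hA - 2 * |A.det| else frobSq A + lam := by
  rw [frobSq_eq_sum_sq_eigenvalues hA, hA.det_eq_prod_eigenvalues]
  rfl

theorem exists_integrand_eq_const_mul_bigF_congr {lam : ℝ} (hlam : 0 ≤ lam) (v : Plane) {ξ : Mat}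
    (hξ : ξ.IsSymm) :
    ∃ N : Mat, IsUnit N.det ∧
      N * ξ * N.transpose = Matrix.diagonal (shape_isHermitian v hξ).eigenvalues ∧
      integrand lam v = fun X => 1 / √lam * √(1 + ‖v‖ ^ 2) * bigF lam (N * X * N.transpose) := by
  obtain ⟨U, hU, hdiag⟩ := exists_orthogonal_diagonalization (shape_isHermitian v hξ)
  have hcongr (X : Mat) : U.transpose * shapeFactor v * X * (U.transpose * shapeFactor v).transpose
      = U.transpose * shape v X * U := by
    rw [shape_eq_shapeFactor_congr, Matrix.transpose_mul, Matrix.transpose_transpose]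
    simp only [Matrix.mul_assoc]
  refine ⟨U.transpose * shapeFactor v, ?_, (hcongr ξ).trans hdiag, funext fun X => ?_⟩
  · rw [Matrix.det_mul]
    exact (Matrix.isUnit_det_of_left_inverse hU).mul (isUnit_det_shapeFactor v)
  · rw [hcongr, bigF_orthogonal_conj lam hU, integrand, Real.rpow_neg hlam, ← Real.sqrt_eq_rpow]
    ring

end WillmoreGraph

end

theorem proposition3p1 (lam : ℝ) (hlam : 0 < lam) (v : WillmoreGraph.Plane)
    (ξ : WillmoreGraph.Mat) (hξ : ξ.IsSymm) :
    -- the integrals in the definition of the quasiconvexification exist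
    (∀ φ G H, WillmoreGraph.IsW2InftyZero φ G H →
      IntegrableOn (fun x => WillmoreGraph.integrand lam v (ξ + H x)) WillmoreGraph.square) ∧
    WillmoreGraph.quasiconvexification (WillmoreGraph.integrand lam v) ξ =
      ((√(1 + ‖v‖ ^ 2) *
        (if WillmoreGraph.rho (WillmoreGraph.shape v ξ) (WillmoreGraph.shape_isHermitian v hξ) ≤ √lam
        then 2 * WillmoreGraph.rho (WillmoreGraph.shape v ξ) (WillmoreGraph.shape_isHermitian v hξ)
            - 2 * (|(WillmoreGraph.shape v ξ).det| / √lam)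
        else WillmoreGraph.frobSq (WillmoreGraph.shape v ξ) / √lam + √lam) : ℝ) : EReal) := by
  obtain ⟨N, hN, hdiag, hintegrand⟩ :=
    WillmoreGraph.exists_integrand_eq_const_mul_bigF_congr hlam.le v hξ
  rw [hintegrand]
  refine ⟨fun φ G H h => WillmoreGraph.integrable_const_mul_bigF_congr h.1 _ _ _ _, ?_⟩
  rw [WillmoreGraph.quasiconvexification_const_mul_bigF_congr hlam (by positivity) hN hξ hdiag,
    WillmoreGraph.relaxed_eigenvalues]
  congr 1
  split_ifs
  · field_simp
  · field_simp
    rw [Real.sq_sqrt hlam.le]
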